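/- Let $(\mathcal X,d_{\mathcal X})$ be a locally compact Polish metric space, let $\mu$ be a Borel probability measure on $\mathcal X$ and $\nu$ a Borel probability measure on $\mathbb R^d$, and let $c:\mathbb R^d\times\mathbb R^d\to[0,+\infty)$ be continuous. For probability measures $\nu_1,\nu_2$ on $\mathbb R^d$ put $$\mathcal T_c(\nu_1,\nu_2)=\inf_{\pi\in\Pi(\nu_1,\nu_2)}\int c(y,y')\,d\pi(y,y')\in[0,+\infty],$$ where $\Pi(\nu_1,\nu_2)$ is the set of probability measures on $\mathbb R^d\times\mathbb R^d$ with first marginal $\nu_1$ and second marginal $\nu_2$. Let $(E_i)_{1\le i\le K}$ be a finite partition of $\mathcal X$ with $\mu(\partial E_i)=0$ for every $i$. Assume: (i) there are a non-decreasing $\eta:[0,+\infty)\to[0,+\infty)$ with $\eta(t)\to+\infty$ as $t\to+\infty$ and an $\alpha\in\mathbb R$ such that $c(y,y')\ge\alpha+\eta(\|y-y'\|_2)$ for all $y,y'\in\mathbb R^d$ and $\int\eta(\|y\|_2)\,d\nu(y)<+\infty$; (ii') for some $L\ge 0$ and, for every $i$, a set $G_i$ of $L$-Lipschitz maps from the interior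 $\mathring E_i$ to $\mathbb R^d$ that is closed for the compact-open topology, $$G=\{g:\mathcal X\to\mathbb R^d \;:\; g|_{\mathring E_i}\in G_i \text{ for every } i\};$$ (iii) there is $g\in G$ with $\mathcal T_c(g\#\mu,\nu)<+\infty$, where $g\#\mu$ is the image measure of $\mu$ by $g$. Here a set $H$ of maps from a space $\mathcal Z$ to $\mathbb R^d$ is called closed for the compact-open topology if there is a sequence $(\mathcal K_m)$ of compact subsets of $\mathcal Z$ with $\bigcup_m\mathcal K_m=\mathcal Z$ such that, for every sequence $(g_n)$ in $H$ for which $(g_n|_{\mathcal K_m})_n$ converges uniformly to some map $h_m:\mathcal K_m\to\mathbb R^d$ for every $m$, there is $g\in H$ with $g|_{\mathcal K_m}=h_m$ for all $m$. Then the problem $\min_{g\in G}\mathcal T_c(g\#\mu,\nu)$ has a solution: there is $g\in G$ with $\mathcal T_c(g\#\mu,\nu)\le\mathcal T_c(h\#\mu,\nu)$ for all $h\in G$. -/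

import Mathlib

open Set Filter Topology MeasureTheory
open scoped NNReal ENNReal

/-- The set `Π(ν₁, ν₂)` of probability measures on `X × Y` whose first marginal is `ν₁` and whose
second marginal is `ν₂`. -/
def couplings {X Y : Type*} [MeasurableSpace X] [MeasurableSpace Y]
    (ν₁ : Measure X) (ν₂ : Measure Y) : Set (Measure (X × Y)) :=
  {π | IsProbabilityMeasure π ∧ π.map Prod.fst = ν₁ ∧ π.map Prod.snd = ν₂}

/-- The optimal transport cost `𝒯_c(ν₁, ν₂) ∈ [0, +∞]` for a ground cost `c : X × Y → ℝ₊`. -/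
noncomputable def transportCost {X Y : Type*} [MeasurableSpace X] [MeasurableSpace Y]
    (c : X × Y → ℝ≥0) (ν₁ : Measure X) (ν₂ : Measure Y) : ℝ≥0∞ :=
  ⨅ π ∈ couplings ν₁ ν₂, ∫⁻ z, (c z : ℝ≥0∞) ∂π

/-- A class `G` of maps is closed for the compact-open topology if there is a sequence of compact
sets covering the domain such that whenever a sequence in `G` converges uniformly on each of these
compact sets, the limits are the restrictions of one element of `G`. -/
def ClosedForCompactOpen {X Y : Type*} [TopologicalSpace X] [UniformSpace Y]
    (G : Set (X → Y)) : Prop :=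
  ∃ K : ℕ → Set X, (∀ m, IsCompact (K m)) ∧ (⋃ m, K m) = univ ∧
    ∀ g : ℕ → X → Y, (∀ n, g n ∈ G) →
      ∀ gK : (m : ℕ) → K m → Y,
        (∀ m, TendstoUniformly (fun n => (K m).domRestrict (g n)) (gK m) atTop) →
          ∃ g' ∈ G, ∀ m, (K m).domRestrict g' = gK m

/-- The maps `g : X → Y` whose restriction to the interior of each `E i` belongs to `G i`
(with no condition outside these interiors). -/
def piecewiseClass {X Y ι : Type*} [TopologicalSpace X] (E : ι → Set X)
    (G : (i : ι) → Set (interior (E i) → Y)) : Set (X → Y) :=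
  {g | ∀ i, (interior (E i)).domRestrict g ∈ G i}

/-- The coercivity assumption on the cost: `c(y, y') ≥ α + η(‖y - y'‖₂)` for some `α ∈ ℝ` and
some non-decreasing `η : ℝ₊ → ℝ₊` tending to `+∞` at `+∞` such that `∫ η(‖·‖₂) dν < +∞`. -/
def CoerciveCost {d : ℕ} (c : EuclideanSpace ℝ (Fin d) × EuclideanSpace ℝ (Fin d) → ℝ≥0)
    (ν : Measure (EuclideanSpace ℝ (Fin d))) : Prop :=
  ∃ (η : ℝ≥0 → ℝ≥0) (α : ℝ), Monotone η ∧ Tendsto η atTop atTop ∧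
    (∀ y y' : EuclideanSpace ℝ (Fin d), α + (η ‖y - y'‖₊ : ℝ) ≤ (c (y, y') : ℝ)) ∧
    ∫⁻ y, (η ‖y‖₊ : ℝ≥0∞) ∂ν < ⊤

/-!
The proof is the direct method. Take maps `g n` in the class and couplings `π n` of `μ.map (g n)`
with `ν` whose costs tend to the infimum, which is finite.

* Coercivity of the cost makes the couplings, hence the measures `μ.map (g n)`, uniformly tight
  (`CoerciveCost.exists_closedBall_compl_le`). Since `η → ∞`, a bounded cost keeps the two
  points of a pair close with high probability, and the second point has the fixed law `ν`.
* On a piece with interior of positive measure, tightness and the common Lipschitz constant bound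
  `g n` at every point (`isBounded_range_of_lipschitzWith_of_measure_le`). On the other pieces the
  values are irrelevant almost everywhere, and `g 0` can be used instead of `g n`.
* An Arzelà–Ascoli argument (`Equicontinuous.exists_strictMono_tendsto`) gives a subsequence that
  converges pointwise on all the interiors, hence uniformly on compact sets by equicontinuity, and
  the closedness assumption puts the limit in the class (`exists_piecewise_tendsto`). As the
  frontiers are null, the convergence holds almost everywhere.
* The transport cost is lower semicontinuous along this subsequence, by Prokhorov's theorem and the
  portmanteau theorem (`transportCost_map_le_of_ae_tendsto`), so the limit is a minimizer.
-/

/-! ### Compactness of equicontinuous sequences -/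

/-- A pointwise bounded equicontinuous sequence on a separable space, with values in a proper space,
has a pointwise convergent subsequence: extract one that converges on a countable dense set, and
use equicontinuity to see that it is Cauchy at every other point. -/
theorem Equicontinuous.exists_strictMono_tendsto {Z Y : Type*} [TopologicalSpace Z]
    [TopologicalSpace.SeparableSpace Z] [PseudoMetricSpace Y] [ProperSpace Y] {F : ℕ → Z → Y}
    (hF : Equicontinuous F) (hb : ∀ z, Bornology.IsBounded (range fun n => F n z)) :
    ∃ φ : ℕ → ℕ, StrictMono φ ∧ ∃ f : Z → Y, Tendsto (F ∘ φ) atTop (𝓝 f) := by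
  obtain ⟨D, hDc, hDd⟩ := TopologicalSpace.exists_countable_dense Z
  have : Countable D := hDc.to_subtype
  have hcomp : IsCompact (univ.pi fun z : D => closure (range fun n => F n z)) :=
    isCompact_univ_pi fun z => (hb z).isCompact_closure
  obtain ⟨a, -, φ, hφ, ha⟩ := hcomp.tendsto_subseq (x := fun n (z : D) => F n z)
    fun n => mem_univ_pi.2 fun z => subset_closure ⟨n, rfl⟩
  have hD : ∀ x ∈ D, CauchySeq fun n => F (φ n) x := fun x hx =>
    (tendsto_pi_nhds.1 ha ⟨x, hx⟩).cauchySeq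
  have hZ : ∀ z, CauchySeq fun n => F (φ n) z := by
    intro z
    rw [Metric.cauchySeq_iff]
    intro ε hε
    obtain ⟨x, hxD, hx⟩ := hDd.inter_nhds_nonempty
      (Metric.equicontinuousAt_iff_right.1 (hF z) (ε / 3) (by positivity))
    obtain ⟨N, hN⟩ := Metric.cauchySeq_iff.1 (hD x hxD) (ε / 3) (by positivity)
    refine ⟨N, fun m hm n hn => ?_⟩
    have h1 := hx (φ m)
    have h2 := hx (φ n)
    have h3 := hN m hm n hn
    have h4 := dist_triangle4 (F (φ m) z) (F (φ m) x) (F (φ n) x) (F (φ n) z)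
    rw [dist_comm (F (φ n) x)] at h4
    linarith
  choose f hf using fun z => cauchySeq_tendsto_of_complete (hZ z)
  exact ⟨φ, hφ, f, tendsto_pi_nhds.2 hf⟩

/-- On each compact set of the cover, pointwise convergence of an equicontinuous sequence is
uniform, so a class closed for the compact-open topology contains the pointwise limits of its
equicontinuous sequences. -/
theorem ClosedForCompactOpen.mem_of_tendsto {Z Y : Type*} [TopologicalSpace Z] [UniformSpace Y]
    [T2Space Y] {G : Set (Z → Y)} (hG : ClosedForCompactOpen G) {g : ℕ → Z → Y} {f : Z → Y}
    (hg : ∀ n, g n ∈ G) (hequi : Equicontinuous g) (hlim : Tendsto g atTop (𝓝 f)) : f ∈ G := by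
  obtain ⟨K, hK, hcover, hG⟩ := hG
  obtain ⟨g', hg', hgf⟩ := hG g hg (fun m => (K m).domRestrict f) fun m => by
    have : CompactSpace (K m) := isCompact_iff_compactSpace.1 (hK m)
    have he : Equicontinuous fun n => (K m).domRestrict (g n) := fun x U hU =>
      continuousAt_subtype_val.eventually (hequi x U hU)
    have := (he.tendsto_uniformFun_iff_pi atTop ((K m).domRestrict f)).2
      (tendsto_pi_nhds.2 fun x => tendsto_pi_nhds.1 hlim x)
    exact UniformFun.tendsto_iff_tendstoUniformly.1 this
  convert! hg'
  ext z
  obtain ⟨m, hm⟩ := mem_iUnion.1 (hcover.symm ▸ mem_univ z : z ∈ ⋃ m, K m)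
  exact (congrFun (hgf m) ⟨z, hm⟩).symm

/-! ### Tightness from the coercivity of the cost -/

/-- Couplings with second marginal `ν` and cost at most `M` are uniformly tight: a bounded cost
keeps `‖y - y'‖` bounded with high probability, and the law `ν` of `y'` is tight by itself. -/
theorem CoerciveCost.exists_closedBall_compl_le {d : ℕ}
    {c : EuclideanSpace ℝ (Fin d) × EuclideanSpace ℝ (Fin d) → ℝ≥0}
    {ν : Measure (EuclideanSpace ℝ (Fin d))} [IsProbabilityMeasure ν] (hcν : CoerciveCost c ν)
    (hc : Continuous c) (M : ℝ≥0) {ε : ℝ≥0∞} (hε : 0 < ε) :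
    ∃ R : ℝ, ∀ ν₁ : Measure (EuclideanSpace ℝ (Fin d)), ∀ π ∈ couplings ν₁ ν,
      ∫⁻ z, (c z : ℝ≥0∞) ∂π ≤ M → π (Metric.closedBall 0 R)ᶜ ≤ ε := by
  obtain ⟨η, α, -, hη, hηc, -⟩ := hcν
  have hε2 : 0 < ε / 2 := ENNReal.half_pos hε.ne'
  -- `C` carries all but `ε / 2` of `ν`, and `A` is the cost level that Markov's inequality allows
  -- `π` to exceed with probability at most `ε / 2`.
  obtain ⟨C, hC, hνC⟩ := isTightMeasureSet_iff_exists_isCompact_measure_compl_le.1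
    (isTightMeasureSet_singleton (μ := ν)) (ε / 2) hε2
  obtain ⟨r, hr⟩ := hC.isBounded.subset_closedBall 0
  obtain ⟨A, hA0, hA⟩ : ∃ A : ℝ≥0, A ≠ 0 ∧ (M : ℝ≥0∞) / A ≤ ε / 2 := by
    have h : Tendsto (fun A : ℝ≥0 => (M : ℝ≥0∞) / A) atTop (𝓝 0) := by
      have := ENNReal.Tendsto.const_div (a := M) (b := ∞) (m := fun A : ℝ≥0 => (A : ℝ≥0∞))
        (ENNReal.tendsto_coe_nhds_top.2 tendsto_id) (Or.inr ENNReal.coe_ne_top)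
      simpa using this
    obtain ⟨A, hA, hA'⟩ := ((eventually_ne_atTop 0).and (h.eventually (ge_mem_nhds hε2))).exists
    exact ⟨A, hA, hA'⟩
  obtain ⟨t, ht⟩ := eventually_atTop.1
    (hη.eventually (eventually_ge_atTop (A + Real.toNNReal (-α))))
  -- A pair of cost less than `A` has its points within distance `t` of each other.
  refine ⟨r + t, fun ν₁ π hπ hM => ?_⟩
  have hsub : (Metric.closedBall (0 : EuclideanSpace ℝ (Fin d) × EuclideanSpace ℝ (Fin d))
      (r + t))ᶜ ⊆ {z | (A : ℝ≥0∞) ≤ c z} ∪ Prod.snd ⁻¹' Cᶜ := by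
    rintro ⟨y, y'⟩ hz
    by_contra hcon
    rw [mem_union, not_or] at hcon
    obtain ⟨h1, h2⟩ := hcon
    have h2 : y' ∈ C := by simpa using h2
    have h1 : c (y, y') < A := by simpa using h1
    have hy' : ‖y'‖ ≤ r := by simpa using hr h2
    have hd : ‖y - y'‖₊ ≤ t := by
      by_contra! hlt
      have h3 := hηc y y'
      have h4 : (A : ℝ) + Real.toNNReal (-α) ≤ η ‖y - y'‖₊ := mod_cast ht _ hlt.le
      have h5 := Real.le_coe_toNNReal (-α)
      have h6 : (c (y, y') : ℝ) < A := mod_cast h1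
      linarith
    have hd' : ‖y - y'‖ ≤ t := mod_cast hd
    have := norm_le_norm_sub_add y y'
    refine hz ?_
    rw [mem_closedBall_zero_iff, Prod.norm_def]
    exact max_le (by simp; linarith) (by simp; linarith [t.coe_nonneg])
  calc π (Metric.closedBall 0 (r + t))ᶜ
      ≤ π {z | (A : ℝ≥0∞) ≤ c z} + π (Prod.snd ⁻¹' Cᶜ) :=
        (measure_mono hsub).trans (measure_union_le _ _)
    _ ≤ ε / 2 + ε / 2 := by
        gcongr
        · refine (meas_ge_le_lintegral_div ?_ (by simpa using hA0) ENNReal.coe_ne_top).trans ?_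
          · exact (ENNReal.continuous_coe.comp hc).measurable.aemeasurable
          · exact (ENNReal.div_le_div_right hM _).trans hA
        · rw [← Measure.map_apply measurable_snd hC.measurableSet.compl, hπ.2.2]
          exact hνC ν rfl
    _ = ε := ENNReal.add_halves ε

/-! ### Lower semicontinuity of the transport cost -/

theorem lintegral_le_of_tendsto_probabilityMeasure {Ω : Type*} [MeasurableSpace Ω]
    [TopologicalSpace Ω] [OpensMeasurableSpace Ω] [HasOuterApproxClosed Ω] {c : Ω → ℝ≥0}
    (hc : Continuous c) {π : ProbabilityMeasure Ω} {πs : ℕ → ProbabilityMeasure Ω}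
    (hπ : Tendsto πs atTop (𝓝 π)) {a : ℕ → ℝ≥0∞} {T : ℝ≥0∞} (ha : Tendsto a atTop (𝓝 T))
    (hle : ∀ n, ∫⁻ z, (c z : ℝ≥0∞) ∂(πs n) ≤ a n) : ∫⁻ z, (c z : ℝ≥0∞) ∂π ≤ T := by
  have h := lintegral_le_liminf_lintegral_of_forall_isOpen_measure_le_liminf_measure
    (μ := π) (μs := fun n => πs n) (NNReal.continuous_coe.comp hc) (fun z => (c z).coe_nonneg)
    fun U hU => ProbabilityMeasure.le_liminf_measure_open_of_tendsto hπ hU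
  simp only [Function.comp_apply, ENNReal.ofReal_coe_nnreal] at h
  exact h.trans ((liminf_le_liminf (Eventually.of_forall hle)).trans ha.liminf_eq.le)

/-- Lower semicontinuity of `𝒯_c(·, ν)` along images of `μ` by almost everywhere convergent maps,
given tight couplings of controlled cost. By Prokhorov's theorem the couplings have a weakly
convergent subsequence, whose limit couples the limits of the marginals. -/
theorem transportCost_map_le_of_ae_tendsto {X Y : Type*} [MeasurableSpace X]
    [MetricSpace Y] [SecondCountableTopology Y] [MeasurableSpace Y] [BorelSpace Y]
    {c : Y × Y → ℝ≥0} (hc : Continuous c) {μ : Measure X} [IsProbabilityMeasure μ]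
    {ν : Measure Y} {g : ℕ → X → Y} {f : X → Y} (hg : ∀ n, AEMeasurable (g n) μ)
    (hlim : ∀ᵐ x ∂μ, Tendsto (fun n => g n x) atTop (𝓝 (f x)))
    {π : ℕ → Measure (Y × Y)} (hπ : ∀ n, π n ∈ couplings (μ.map (g n)) ν)
    (htight : IsTightMeasureSet (range π)) {a : ℕ → ℝ≥0∞} {T : ℝ≥0∞} (ha : Tendsto a atTop (𝓝 T))
    (hle : ∀ n, ∫⁻ z, (c z : ℝ≥0∞) ∂(π n) ≤ a n) : transportCost c (μ.map f) ν ≤ T := by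
  have hf : AEMeasurable f μ := aemeasurable_of_tendsto_metrizable_ae atTop hg hlim
  let P : ℕ → ProbabilityMeasure (Y × Y) := fun n => ⟨π n, (hπ n).1⟩
  have hcomp : IsCompact (closure (range P)) := isCompact_closure_of_isTightMeasureSet
    (htight.subset (by rintro _ ⟨_, ⟨n, rfl⟩, rfl⟩; exact ⟨n, rfl⟩))
  obtain ⟨Q, -, φ, hφ, hQ⟩ := hcomp.tendsto_subseq fun n => subset_closure ⟨n, rfl⟩
  have hfst : (Q : Measure (Y × Y)).map Prod.fst = μ.map f := by
    have h1 := (tendstoInDistribution_of_ae_tendsto hg hf hlim).tendsto.comp hφ.tendsto_atTop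
    have h2 := ProbabilityMeasure.tendsto_map_of_tendsto_of_continuous _ _ hQ
      (continuous_fst (X := Y) (Y := Y))
    refine congrArg ((↑) : ProbabilityMeasure Y → Measure Y)
      (tendsto_nhds_unique h2 (h1.congr fun n => ?_))
    exact Subtype.ext (hπ (φ n)).2.1.symm
  have hsnd : (Q : Measure (Y × Y)).map Prod.snd = ν := by
    have h2 := ProbabilityMeasure.tendsto_map_of_tendsto_of_continuous _ _ hQ
      (continuous_snd (X := Y) (Y := Y))
    have hν : ∀ n, (P n).map measurable_snd.aemeasurable = (P 0).map measurable_snd.aemeasurable :=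
      fun n => Subtype.ext ((hπ n).2.2.trans (hπ 0).2.2.symm)
    have hQ0 := tendsto_nhds_unique h2 (tendsto_const_nhds.congr fun n => (hν (φ n)).symm)
    exact (congrArg ((↑) : ProbabilityMeasure Y → Measure Y) hQ0).trans (hπ 0).2.2
  exact (iInf₂_le (Q : Measure (Y × Y)) ⟨Q.2, hfst, hsnd⟩).trans
    (lintegral_le_of_tendsto_probabilityMeasure hc hQ (ha.comp hφ.tendsto_atTop) fun n => hle (φ n))

/-! ### Maps that are regular on the interiors of the pieces -/

theorem ae_mem_iUnion_interior {X ι : Type*} [TopologicalSpace X] [MeasurableSpace X] [Countable ι]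
    {μ : Measure X} {E : ι → Set X} (hcover : (⋃ i, E i) = univ)
    (hfrontier : ∀ i, μ (frontier (E i)) = 0) : ∀ᵐ x ∂μ, x ∈ ⋃ i, interior (E i) := by
  filter_upwards [ae_all_iff.2 fun i => measure_eq_zero_iff_ae_notMem.1 (hfrontier i)] with x hx
  obtain ⟨i, hi⟩ := mem_iUnion.1 (hcover.symm ▸ mem_univ x : x ∈ ⋃ i, E i)
  refine mem_iUnion.2 ⟨i, ?_⟩
  by_contra hint
  exact hx i ⟨subset_closure hi, hint⟩

theorem aemeasurable_of_continuousOn_interior {X Y ι : Type*} [TopologicalSpace X]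
    [MeasurableSpace X] [OpensMeasurableSpace X] [TopologicalSpace Y] [MeasurableSpace Y]
    [BorelSpace Y] [Countable ι] {μ : Measure X} {E : ι → Set X} (hcover : (⋃ i, E i) = univ)
    (hfrontier : ∀ i, μ (frontier (E i)) = 0) {g : X → Y}
    (hg : ∀ i, ContinuousOn g (interior (E i))) : AEMeasurable g μ := by
  rw [← Measure.restrict_eq_self_of_ae_mem (ae_mem_iUnion_interior hcover hfrontier),
    aemeasurable_iUnion_iff]
  exact fun i => (hg i).aemeasurable isOpen_interior.measurableSet

/-- If the maps `g n` are `L`-Lipschitz on a set `U` of positive measure and the image measures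
`μ.map (g n)` are uniformly tight, then `g n` is bounded at each point `z` of `U`: some bounded part
of `U` around `z` has positive measure, so each `g n` takes a value in a fixed ball there. -/
theorem isBounded_range_of_lipschitzWith_of_measure_le {X Y : Type*} [PseudoMetricSpace X]
    [MeasurableSpace X] [PseudoMetricSpace Y] {μ : Measure X} {U : Set X} (hU : μ U ≠ 0)
    {L : ℝ≥0} {g : ℕ → X → Y} (hg : ∀ n, LipschitzWith L (U.domRestrict (g n))) (y₀ : Y)
    (hmass : ∀ ε > 0, ∃ R : ℝ, ∀ n, μ {x | g n x ∉ Metric.closedBall y₀ R} ≤ ε) (z : U) :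
    Bornology.IsBounded (range fun n => g n z) := by
  obtain ⟨r, hr⟩ : ∃ r : ℕ, μ (U ∩ Metric.closedBall z r) ≠ 0 := by
    by_contra! hcon
    refine hU (measure_mono_null ?_ (measure_iUnion_null hcon))
    intro x hx
    obtain ⟨r, hr⟩ := exists_nat_ge (dist x z)
    exact mem_iUnion.2 ⟨r, hx, hr⟩
  obtain ⟨ε, hε0, hε⟩ := exists_between (pos_iff_ne_zero.2 hr)
  obtain ⟨R, hR⟩ := hmass ε hε0
  refine (Metric.isBounded_closedBall (x := y₀) (r := L * r + R)).subset ?_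
  rintro _ ⟨n, rfl⟩
  obtain ⟨x, ⟨hxU, hxz⟩, hx⟩ : ∃ x ∈ U ∩ Metric.closedBall (z : X) r,
      g n x ∈ Metric.closedBall y₀ R := by
    by_contra! hcon
    exact ((measure_mono hcon).trans (hR n)).not_gt hε
  have h1 : dist (g n z) (g n x) ≤ L * r :=
    ((hg n).dist_le_mul z ⟨x, hxU⟩).trans (by
      gcongr
      rw [dist_comm]
      exact hxz)
  exact (dist_triangle _ _ _).trans (add_le_add h1 hx)

/-- Compactness of the Lipschitz classes, simultaneously on disjoint pieces `U i`. A single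
extraction on the disjoint sum `Σ i, U i` handles all the pieces, and the limits on the pieces are
then glued to one map. -/
theorem exists_piecewise_tendsto {X Y ι : Type*} [PseudoMetricSpace X] [SecondCountableTopology X]
    [MetricSpace Y] [ProperSpace Y] [Nonempty Y] [Countable ι] {U : ι → Set X}
    (hU : Pairwise (Function.onFun Disjoint U)) {L : ℝ≥0} {G : (i : ι) → Set (U i → Y)}
    (hLip : ∀ i, ∀ g ∈ G i, LipschitzWith L g) (hclosed : ∀ i, ClosedForCompactOpen (G i))
    {u : ℕ → (i : ι) → U i → Y} (hu : ∀ n i, u n i ∈ G i)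
    (hb : ∀ i z, Bornology.IsBounded (range fun n => u n i z)) :
    ∃ φ : ℕ → ℕ, StrictMono φ ∧ ∃ f : X → Y, (∀ i, (U i).domRestrict f ∈ G i) ∧
      ∀ i (z : U i), Tendsto (fun n => u (φ n) i z) atTop (𝓝 (f z)) := by
  classical
  have hequi : ∀ i, Equicontinuous fun n => u n i := fun i =>
    (LipschitzWith.uniformEquicontinuous _ L fun n => hLip i _ (hu n i)).equicontinuous
  let F : ℕ → (Σ i, U i) → Y := fun n z => u n z.1 z.2
  have hF : Equicontinuous F := by
    rintro ⟨i, z⟩ V hV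
    rw [Sigma.nhds_mk, eventually_map]
    exact hequi i z V hV
  obtain ⟨φ, hφ, f, hf⟩ := hF.exists_strictMono_tendsto fun z => hb z.1 z.2
  rw [tendsto_pi_nhds] at hf
  let f' : X → Y := fun x =>
    if h : ∃ i, x ∈ U i then f ⟨h.choose, x, h.choose_spec⟩ else Classical.arbitrary Y
  have hf' : ∀ i (z : U i), f' z = f ⟨i, z⟩ := by
    rintro i ⟨x, hx⟩
    have h : ∃ i, x ∈ U i := ⟨i, hx⟩
    obtain rfl : h.choose = i := by
      by_contra hne
      exact disjoint_left.1 (hU hne) h.choose_spec hx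
    exact dif_pos h
  have hlim : ∀ i (z : U i), Tendsto (fun n => u (φ n) i z) atTop (𝓝 (f' z)) := fun i z => by
    rw [hf']
    exact hf ⟨i, z⟩
  exact ⟨φ, hφ, f', fun i => (hclosed i).mem_of_tendsto (fun n => hu (φ n) i)
    (fun x V hV => (hequi i x V hV).mono fun y hy n => hy (φ n))
    (tendsto_pi_nhds.2 (hlim i)), hlim⟩

/-! ### Existence of a minimizer -/

theorem mainTheorem2 {X : Type*} [MetricSpace X] [PolishSpace X] [LocallyCompactSpace X]
    [MeasurableSpace X] [BorelSpace X] {d : ℕ}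
    (c : EuclideanSpace ℝ (Fin d) × EuclideanSpace ℝ (Fin d) → ℝ≥0) (hc : Continuous c)
    (μ : Measure X) [IsProbabilityMeasure μ]
    (ν : Measure (EuclideanSpace ℝ (Fin d))) [IsProbabilityMeasure ν]
    (hcoercive : CoerciveCost c ν)
    {K : ℕ} (E : Fin K → Set X)
    (hdisjoint : Pairwise (Function.onFun Disjoint E)) (hcover : (⋃ i, E i) = univ)
    (hfrontier : ∀ i, μ (frontier (E i)) = 0)
    (L : ℝ≥0) (G : (i : Fin K) → Set (interior (E i) → EuclideanSpace ℝ (Fin d)))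
    (hLip : ∀ i, ∀ g ∈ G i, LipschitzWith L g)
    (hclosed : ∀ i, ClosedForCompactOpen (G i))
    (hfinite : ∃ g ∈ piecewiseClass E G, transportCost c (μ.map g) ν < ⊤) :
    ∃ g ∈ piecewiseClass E G, ∀ h ∈ piecewiseClass E G,
      transportCost c (μ.map g) ν ≤ transportCost c (μ.map h) ν := by
  classical
  have hmeas : ∀ g ∈ piecewiseClass E G, AEMeasurable g μ := fun g hg =>
    aemeasurable_of_continuousOn_interior hcover hfrontier fun i =>
      continuousOn_iff_continuous_domRestrict.2 (hLip i _ (hg i)).continuous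
  set T : ℝ≥0∞ := ⨅ g ∈ piecewiseClass E G, transportCost c (μ.map g) ν with hT
  have hTtop : T < ⊤ := by
    obtain ⟨g, hg, hgc⟩ := hfinite
    exact (iInf₂_le g hg).trans_lt hgc
  -- Couplings `π n` of almost minimal cost, chosen together with the maps `g n`.
  obtain ⟨a, ha_anti, ha_mem, ha⟩ := exists_seq_strictAnti_tendsto' hTtop
  have hseq : ∀ n, ∃ g ∈ piecewiseClass E G, ∃ π ∈ couplings (μ.map g) ν,
      ∫⁻ z, (c z : ℝ≥0∞) ∂π ≤ a n := by
    intro n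
    have h1 := (ha_mem n).1
    simp only [hT, iInf_lt_iff] at h1
    obtain ⟨g, hg, h2⟩ := h1
    simp only [transportCost, iInf_lt_iff] at h2
    obtain ⟨π, hπ, h3⟩ := h2
    exact ⟨g, hg, π, hπ, h3.le⟩
  choose g hg π hπ hcost using hseq
  lift a 0 to ℝ≥0 using (ha_mem 0).2.ne with M hM
  have hball : ∀ ε > 0, ∃ R : ℝ, ∀ n, π n (Metric.closedBall 0 R)ᶜ ≤ ε := fun ε hε => by
    obtain ⟨R, hR⟩ := hcoercive.exists_closedBall_compl_le hc M hε
    exact ⟨R, fun n => hR _ (π n) (hπ n)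
      ((hcost n).trans ((ha_anti.antitone (Nat.zero_le n)).trans hM.ge))⟩
  have htight : IsTightMeasureSet (range π) := by
    rw [isTightMeasureSet_iff_exists_isCompact_measure_compl_le]
    intro ε hε
    obtain ⟨R, hR⟩ := hball ε hε
    exact ⟨_, isCompact_closedBall 0 R, by rintro _ ⟨n, rfl⟩; exact hR n⟩
  have hmass : ∀ ε > 0, ∃ R : ℝ, ∀ n, μ {x | g n x ∉ Metric.closedBall 0 R} ≤ ε := fun ε hε => by
    obtain ⟨R, hR⟩ := hball ε hε
    refine ⟨R, fun n => le_trans ?_ (hR n)⟩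
    have hB : MeasurableSet (Metric.closedBall (0 : EuclideanSpace ℝ (Fin d)) R)ᶜ :=
      Metric.isClosed_closedBall.measurableSet.compl
    calc μ {x | g n x ∉ Metric.closedBall 0 R}
        = π n (Prod.fst ⁻¹' (Metric.closedBall (0 : EuclideanSpace ℝ (Fin d)) R)ᶜ) := by
          rw [← Measure.map_apply measurable_fst hB, (hπ n).2.1,
            Measure.map_apply_of_aemeasurable (hmeas _ (hg n)) hB]
          rfl
      _ ≤ π n (Metric.closedBall 0 R)ᶜ := by
          refine measure_mono fun z hz hz' => hz ?_
          rw [mem_closedBall_zero_iff] at hz' ⊢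
          exact (norm_fst_le z).trans hz'
  -- On a piece whose interior is `μ`-null, nothing bounds the minimizing sequence; it is replaced
  -- there by the constant sequence `g 0`, which does not affect almost everywhere convergence.
  let u : ℕ → (i : Fin K) → interior (E i) → EuclideanSpace ℝ (Fin d) := fun n i =>
    (interior (E i)).domRestrict (if μ (interior (E i)) = 0 then g 0 else g n)
  have hu : ∀ n i, u n i ∈ G i := fun n i => by
    by_cases h : μ (interior (E i)) = 0
    · simpa only [u, if_pos h] using hg 0 i
    · simpa only [u, if_neg h] using hg n i
  have hb : ∀ i z, Bornology.IsBounded (range fun n => u n i z) := fun i z => by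
    by_cases h : μ (interior (E i)) = 0
    · simp only [u, if_pos h, range_const]
      exact Bornology.isBounded_singleton
    · simp only [u, if_neg h]
      exact isBounded_range_of_lipschitzWith_of_measure_le h (fun n => hLip i _ (hg n i)) 0 hmass z
  obtain ⟨φ, hφ, f, hfG, hlim⟩ := exists_piecewise_tendsto
    (fun i j hij => (hdisjoint hij).mono interior_subset interior_subset) hLip hclosed hu hb
  have hae : ∀ᵐ x ∂μ, Tendsto (fun n => g (φ n) x) atTop (𝓝 (f x)) := by
    have hnull : ∀ᵐ x ∂μ, ∀ i, μ (interior (E i)) = 0 → x ∉ interior (E i) := by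
      refine ae_all_iff.2 fun i => ?_
      by_cases h : μ (interior (E i)) = 0
      · simpa [h] using measure_eq_zero_iff_ae_notMem.1 h
      · simp [h]
    filter_upwards [ae_mem_iUnion_interior hcover hfrontier, hnull] with x hx hxn
    obtain ⟨i, hi⟩ := mem_iUnion.1 hx
    have h := hlim i ⟨x, hi⟩
    simp only [u, if_neg fun h0 => hxn i h0 hi] at h
    exact h
  suffices hfT : transportCost c (μ.map f) ν ≤ T from
    ⟨f, hfG, fun h hh => hfT.trans (iInf₂_le h hh)⟩
  exact transportCost_map_le_of_ae_tendsto hc (fun n => hmeas _ (hg (φ n))) hae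
    (fun n => hπ (φ n)) (htight.subset (range_comp_subset_range φ π)) (ha.comp hφ.tendsto_atTop)
    fun n => hcost (φ n)
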